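/- Conventions. A Krull domain is a domain $A$ that equals $\bigcap_{\mathfrak p}A_{\mathfrak p}$ ($\mathfrak p$ running over the primes of height $1$), such that every such $A_{\mathfrak p}$ is a discrete valuation ring and every nonzero element of $A$ lies in only finitely many primes of height $1$. Let $A$ be a noetherian Krull domain. A finitely generated torsion $A$-module is pseudo-null if its annihilator has height at least $2$; a homomorphism is a pseudo-isomorphism if its kernel and cokernel are pseudo-null. For a finitely generated $A$-module $M$ the characteristic ideal $Ch_A(M)$ is $0$ if $M$ is not torsion; if $M$ is torsion and $M\to\bigoplus_{i=1}^n A/\mathfrak p_i^{e_i}$ is a pseudo-isomorphism, with $\mathfrak p_i$ primes of height $1$, then $Ch_A(M)$ is the product of the $\mathfrak p_i^{e_i}$ in the group of divisors of $A$, i.e. the divisorial ideal $\bigcap_{\mathfrak p}\big(A\cap \prod_i\mathfrak p_i^{e_i}A_{\mathfrak p}\big)$, $\mathfrak p$ running over the primes of height $1$ (this is the ordinary product $\prod_i \mathfrak p_i^{e_i}$ if $A$ is a unique factorization domain). Theorem. Let $(\Lambda_d)_{d\ge 0}$ be an inverse system of noetherian Krull domains with surjective transition maps $\pi^{d+1}_{d}\colon\Lambda_{d+1}\to\Lambda_d$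 whose kernel $\mathfrak p_{d+1}=(t_{d+1})$ is a principal prime ideal of height $1$, and suppose that $\Lambda_{d+1}\simeq\varprojlim_n\Lambda_{d+1}/\mathfrak p_{d+1}^n$, for all $d\ge 0$. Let $\Lambda=\varprojlim_d\Lambda_d$ with projections $\pi_d\colon\Lambda\to\Lambda_d$. Let $(M_d)_{d\ge0}$ be an inverse system of finitely generated $\Lambda_d$-modules, with transition maps semilinear over the $\pi^{d+1}_d$, such that the $\Lambda$-module $M=\varprojlim_d M_d$ is finitely generated. Suppose that there is $d_0$ such that for all $d>d_0$: 1. the $\mathfrak p_d$-torsion submodule $(M_d)_{t_d}=\{m\in M_d: t_dm=0\}$ is a pseudo-null $\Lambda_{d-1}$-module; 2. $Ch_{\Lambda_{d-1}}(M_d/t_dM_d)\subseteq Ch_{\Lambda_{d-1}}(M_{d-1})$. Then $\pi^{d}_{d-1}\big(Ch_{\Lambda_d}(M_d)\big)\subseteq Ch_{\Lambda_{d-1}}(M_{d-1})$ for all $d>d_0$, so that the ideals $Ch_{\Lambda_d}(M_d)$, $d\ge d_0$, form an inverse system, and their preimages $\pi_d^{-1}(Ch_{\Lambda_d}(M_d))$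 a decreasing sequence of ideals of $\Lambda$. Consequently the pro-characteristic ideal $$\widetilde{Ch}_\Lambda(M):=\varprojlim_{d\ge d_0}\pi_d^{-1}\big(Ch_{\Lambda_d}(M_d)\big)=\bigcap_{d\ge d_0}\pi_d^{-1}\big(Ch_{\Lambda_d}(M_d)\big)$$ is well defined: it is the inverse limit of the ideals $\pi_d^{-1}(Ch_{\Lambda_d}(M_d))$ under the inclusions, it is identified through the maps $\pi_d$ with $\varprojlim_{d\ge d_0}Ch_{\Lambda_d}(M_d)$, and it does not change if $d_0$ is replaced by any $d_1\ge d_0$. -/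

import Mathlib

open scoped DirectSum

universe u v w

/-- The prime ideals of height one of a commutative ring. -/
abbrev HeightOnePrime (A : Type u) [CommRing A] : Type u :=
  {p : PrimeSpectrum A // p.asIdeal.height = 1}

/-- A domain `A` is a Krull domain if `A` is the intersection (in its fraction field) of its
localizations at primes of height one, all these localizations are discrete valuation rings, and
every nonzero element lies in only finitely many primes of height one. -/
structure IsKrullDomain (A : Type u) [CommRing A] [IsDomain A] : Prop where
  eq_inter : ∀ x : FractionRing A,
    (∀ p : HeightOnePrime A, ∃ a s : A, s ∉ p.1.asIdeal ∧
      x * algebraMap A (FractionRing A) s = algebraMap A (FractionRing A) a) →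
    ∃ a : A, algebraMap A (FractionRing A) a = x
  isDVR : ∀ p : HeightOnePrime A, IsDiscreteValuationRing (Localization.AtPrime p.1.asIdeal)
  finite_character : ∀ x : A, x ≠ 0 → {p : HeightOnePrime A | x ∈ p.1.asIdeal}.Finite

/-- A module is pseudo-null if it is finitely generated and torsion, and its annihilator has height
at least two (the unit ideal has height `⊤`, so the zero module is pseudo-null). -/
def IsPseudoNull (A : Type u) [CommRing A] (M : Type v) [AddCommGroup M] [Module A M] : Prop :=
  Module.Finite A M ∧ Module.IsTorsion A M ∧ 2 ≤ (Module.annihilator A M).height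

/-- A linear map is a pseudo-isomorphism if its kernel and its cokernel are pseudo-null. -/
def IsPseudoIso {A : Type u} [CommRing A] {M : Type v} {N : Type w} [AddCommGroup M] [Module A M]
    [AddCommGroup N] [Module A N] (f : M →ₗ[A] N) : Prop :=
  IsPseudoNull A (LinearMap.ker f) ∧ IsPseudoNull A (N ⧸ LinearMap.range f)

/-- The divisorial hull `⋂ₚ (I A_p ∩ A)` of an ideal `I` of a Krull domain, where `p` runs through
the primes of height one. If `I = ∏ pᵢ ^ eᵢ`, this is the divisorial ideal attached to the divisor
`∑ eᵢ pᵢ`, that is, the product of the `pᵢ ^ eᵢ` in the group of divisors. It is `I` itself when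
`I` is principal, in particular for all such products over a unique factorization domain. -/
def divisorialHull {A : Type u} [CommRing A] (I : Ideal A) : Ideal A :=
  ⨅ p : HeightOnePrime A,
    (I.map (algebraMap A (Localization.AtPrime p.1.asIdeal))).comap
      (algebraMap A (Localization.AtPrime p.1.asIdeal))

/-- `I` is a characteristic ideal of `M`: either `M` is not torsion and `I = 0`, or `M` is torsion,
`M` is pseudo-isomorphic to an elementary module `⨁ᵢ A ⧸ pᵢ ^ eᵢ` with primes `pᵢ` of height one, and
`I` is the (divisorial) product of the `pᵢ ^ eᵢ`. -/
def IsCharIdeal (A : Type u) [CommRing A] (M : Type v) [AddCommGroup M] [Module A M]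
    (I : Ideal A) : Prop :=
  (¬ Module.IsTorsion A M ∧ I = ⊥) ∨
  (Module.IsTorsion A M ∧
    ∃ (n : ℕ) (p : Fin n → HeightOnePrime A) (e : Fin n → ℕ)
      (f : M →ₗ[A] ⨁ i : Fin n, A ⧸ (p i).1.asIdeal ^ e i),
      IsPseudoIso f ∧ I = divisorialHull (∏ i, (p i).1.asIdeal ^ e i))

open Classical in
/-- The characteristic ideal of a module. For a finitely generated module over a noetherian Krull
domain there is exactly one `I` with `IsCharIdeal A M I`, and this is it. -/
noncomputable def charIdeal (A : Type u) [CommRing A] (M : Type v) [AddCommGroup M] [Module A M] :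
    Ideal A :=
  if h : ∃ I : Ideal A, IsCharIdeal A M I then h.choose else ⊥

section Descent

variable {R : Type u} {S : Type v} [CommRing R] [CommRing S] (φ : R →+* S)
  (hφ : Function.Surjective φ) (M : Type w) [AddCommGroup M] [Module R M]

/-- For `φ : R → S` surjective with kernel `𝔭`, so that `S ≅ R ⧸ 𝔭`: the `S`-module structure on the
`𝔭`-torsion submodule `{m | 𝔭 m = 0}` of an `R`-module `M`. -/
@[reducible]
noncomputable def torsionDescent : Module S (Submodule.torsionBySet R M (RingHom.ker φ)) :=
  Module.compHom _ (RingHom.quotientKerEquivOfSurjective hφ).symm.toRingHom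

/-- For `φ : R → S` surjective with kernel `𝔭`, so that `S ≅ R ⧸ 𝔭`: the `S`-module structure on the
quotient `M ⧸ 𝔭 M` of an `R`-module `M`. -/
@[reducible]
noncomputable def quotientDescent : Module S (M ⧸ RingHom.ker φ • (⊤ : Submodule R M)) :=
  Module.compHom _ (RingHom.quotientKerEquivOfSurjective hφ).symm.toRingHom

theorem torsionDescent_smul (r : R) (m : Submodule.torsionBySet R M (RingHom.ker φ)) :
    letI := torsionDescent φ hφ M
    φ r • m = r • m := by
  change ((RingHom.quotientKerEquivOfSurjective hφ).symm (φ r)) • m = r • m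
  have h : (RingHom.quotientKerEquivOfSurjective hφ).symm (φ r) =
      Ideal.Quotient.mk (RingHom.ker φ) r := by
    rw [RingEquiv.symm_apply_eq]; rfl
  rw [h, Submodule.torsionBySet.mk_smul]

theorem quotientDescent_smul (r : R) (m : M ⧸ RingHom.ker φ • (⊤ : Submodule R M)) :
    letI := quotientDescent φ hφ M
    φ r • m = r • m := by
  change ((RingHom.quotientKerEquivOfSurjective hφ).symm (φ r)) • m = r • m
  have h : (RingHom.quotientKerEquivOfSurjective hφ).symm (φ r) =
      Ideal.Quotient.mk (RingHom.ker φ) r := by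
    rw [RingEquiv.symm_apply_eq]; rfl
  rw [h]
  rfl

/-- The `𝔭`-torsion submodule of `M` is a pseudo-null module over `S ≅ R ⧸ 𝔭`. -/
def IsPseudoNullTorsion : Prop :=
  @IsPseudoNull S _ (Submodule.torsionBySet R M (RingHom.ker φ)) _ (torsionDescent φ hφ M)

/-- The characteristic ideal of `M ⧸ 𝔭 M` over `S ≅ R ⧸ 𝔭`. -/
noncomputable def charIdealQuotient : Ideal S :=
  @charIdeal S _ (M ⧸ RingHom.ker φ • (⊤ : Submodule R M)) _ (quotientDescent φ hφ M)

end Descent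

/-- `L`, with the projections `p d : L → X d`, is the inverse limit of the sequence
`⋯ → X 2 → X 1 → X 0` with transition maps `f`. -/
def IsInverseLimit {X : ℕ → Type u} (f : ∀ d, X (d + 1) → X d) {L : Type v}
    (p : ∀ d, L → X d) : Prop :=
  (∀ d l, f d (p (d + 1) l) = p d l) ∧
  ∀ x : ∀ d, X d, (∀ d, f d (x (d + 1)) = x d) → ∃! l, ∀ d, p d l = x d

/-- The preimage `π_d⁻¹(Ch(M_d))` in `L` of the characteristic ideal of `M_d`. -/
noncomputable def charPreimage {L : Type w} [CommRing L] {Λ : ℕ → Type u} [∀ d, CommRing (Λ d)]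
    (π : ∀ d, L →+* Λ d) (M : ℕ → Type v) [∀ d, AddCommGroup (M d)] [∀ d, Module (Λ d) (M d)]
    (d : ℕ) : Ideal L :=
  (charIdeal (Λ d) (M d)).comap (π d)

/-- The pro-characteristic ideal, computed from the levels `d ≥ d₀`: the intersection in `L` of the
ideals `π_d⁻¹(Ch(M_d))`. -/
noncomputable def proCharIdeal {L : Type w} [CommRing L] {Λ : ℕ → Type u} [∀ d, CommRing (Λ d)]
    (π : ∀ d, L →+* Λ d) (M : ℕ → Type v) [∀ d, AddCommGroup (M d)] [∀ d, Module (Λ d) (M d)]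
    (d₀ : ℕ) : Ideal L :=
  ⨅ k : ℕ, charPreimage π M (d₀ + k)

theorem proCharIdeal_le {L : Type w} [CommRing L] {Λ : ℕ → Type u} [∀ d, CommRing (Λ d)]
    (π : ∀ d, L →+* Λ d) (M : ℕ → Type v) [∀ d, AddCommGroup (M d)] [∀ d, Module (Λ d) (M d)]
    (d₀ k : ℕ) : proCharIdeal π M d₀ ≤ charPreimage π M (d₀ + k) :=
  iInf_le _ k

/-! The heart is one descent step. Let `φ : A → B` be surjective with kernel `(t)`, let `N` be a
torsion `A`-module whose `t`-torsion is pseudo-null over `B`, and let `q` be a height one prime of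
`B` with preimage `P` in `A`. At `P` the element `t` acts injectively on `N`, so the relation module
of a surjection `Aⁿ → N` reduces modulo `t` to a submodule of a free module over the discrete
valuation ring `B_q`. Such a submodule is free of rank at most `n`. Lifting a basis, padding with
zeros and applying Nakayama gives a square presentation matrix `D` of `N` at `P`
(`exists_isPresentationAt_comap`).

By comparing lengths, `det D` generates the characteristic ideal of `N` at every height one prime
below `P`, and `φ (det D)` generates that of `N/tN` at `q` (`IsCharIdeal.exists_eq_divisorialHull`).
An element `x` of the former ideal is thus divisible by `det D` at all these primes, hence at `P`
itself, since `A` is a Krull domain (`IsKrullDomain.exists_notMem_mul_eq_mul`). Applying `φ` puts `φ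
x` in the latter ideal at every `q`, which suffices because that ideal is divisorial. The inclusion
between the characteristic ideals of `N/tN` and of the next module finishes the step; the statements
on limits are then formal. -/

/-! ### Lengths and determinants over principal ideal domains -/

theorem Ring.ord_prod {R ι : Type*} [CommRing R] [IsDomain R] (s : Finset ι) {a : ι → R}
    (ha : ∀ i, a i ≠ 0) : Ring.ord R (∏ i ∈ s, a i) = ∑ i ∈ s, Ring.ord R (a i) := by
  classical
  induction s using Finset.induction_on with
  | empty => simp
  | insert i s hi ih =>
    rw [Finset.prod_insert hi, Finset.sum_insert hi,
      Ring.ord_mul' R (mem_nonZeroDivisors_of_ne_zero (ha i)), ih]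

open Module in
/-- Over a principal ideal domain, the cokernel of a square matrix with nonzero determinant has the
same length as the quotient by its determinant. -/
theorem length_quotient_range_toLin' {R : Type*} [CommRing R] [IsDomain R] [IsPrincipalIdealRing R]
    {n : ℕ} (D : Matrix (Fin n) (Fin n) R) (hD : D.det ≠ 0) :
    Module.length R ((Fin n → R) ⧸ LinearMap.range D.toLin') = Ring.ord R D.det := by
  have hinj : Function.Injective D.toLin' := by
    intro x y hxy
    exact Matrix.mulVec_injective_of_det_ne_zero hD (by simpa only [Matrix.toLin'_apply] using hxy)
  set N := LinearMap.range D.toLin' with hN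
  let e : (Fin n → R) ≃ₗ[R] N := LinearEquiv.ofInjective _ hinj
  have hrank : finrank R N = finrank R (Fin n → R) := e.finrank_eq.symm
  let b := Pi.basisFun R (Fin n)
  let a := Submodule.smithNormalFormCoeffs b hrank
  let b' := Submodule.smithNormalFormTopBasis b hrank
  let c := Submodule.smithNormalFormBotBasis b hrank
  have ha : ∀ i, a i ≠ 0 := Submodule.smithNormalFormCoeffs_ne_zero b hrank
  -- `e` comes from `D` and `e'` from the Smith bases; they differ by an automorphism, so the
  -- determinants of their composites with the inclusion are associated.
  let e' : (Fin n → R) ≃ₗ[R] N := b'.equiv c (Equiv.refl _)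
  have h1 : N.subtype ∘ₗ e.toLinearMap = D.toLin' := rfl
  have h2 : LinearMap.det (N.subtype ∘ₗ e'.toLinearMap) = ∏ i, a i := by
    rw [← LinearMap.det_toMatrix b']
    have : LinearMap.toMatrix b' b' (N.subtype ∘ₗ e'.toLinearMap) = Matrix.diagonal a := by
      ext i j
      rw [LinearMap.toMatrix_apply]
      simp only [LinearMap.comp_apply, e', LinearEquiv.coe_coe, Basis.equiv_apply,
        Equiv.refl_apply, Submodule.subtype_apply]
      rw [Submodule.smithNormalFormBotBasis_def]
      by_cases hij : i = j
      · subst hij; simp [b', a]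
      · simp [b', Matrix.diagonal_apply_ne _ hij, Ne.symm hij]
    rw [this, Matrix.det_diagonal]
  have h3 : Associated D.det (∏ i, a i) := by
    have := LinearMap.associated_det_comp_equiv N.subtype e e'
    rwa [h1, h2, LinearMap.det_toLin'] at this
  rw [(Submodule.quotientEquivPiSpan N b hrank).length_eq, Module.length_pi_of_fintype,
    Ring.ord_eq_of_associated h3, Ring.ord_prod _ ha]
  rfl

/-- Up to a unit, each element is a power of a uniformizer, and the length recovers the exponent.
This turns equalities of lengths back into equalities of ideals. -/
theorem IsDiscreteValuationRing.span_eq_of_ord_eq {R : Type*} [CommRing R] [IsDomain R]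
    [IsDiscreteValuationRing R] {a b : R} (ha : a ≠ 0) (hb : b ≠ 0)
    (h : Ring.ord R a = Ring.ord R b) : Ideal.span {a} = Ideal.span {b} := by
  obtain ⟨ϖ, hϖ⟩ := IsDiscreteValuationRing.exists_irreducible R
  obtain ⟨m, hm⟩ := IsDiscreteValuationRing.associated_pow_irreducible ha hϖ
  obtain ⟨n, hn⟩ := IsDiscreteValuationRing.associated_pow_irreducible hb hϖ
  have hpow : ∀ k : ℕ, Ring.ord R (ϖ ^ k) = k := fun k => by
    rw [Ring.ord_pow (mem_nonZeroDivisors_of_ne_zero hϖ.ne_zero), Ring.ord_of_irreducible hϖ]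
    simp
  rw [Ring.ord_eq_of_associated hm, Ring.ord_eq_of_associated hn, hpow, hpow, Nat.cast_inj] at h
  rw [Ideal.span_singleton_eq_span_singleton]
  exact hm.trans (h ▸ hn.symm)

/-! ### Square presentations up to localization -/

section Presentation

variable {A : Type*} [CommRing A] {n : ℕ} {N : Type*} [AddCommGroup N] [Module A N]

/-- The pair `(D, g)` becomes a presentation `Aⁿ → Aⁿ → N → 0` after localization at `S`. -/
structure IsPresentationAt (S : Submonoid A) (D : Matrix (Fin n) (Fin n) A)
    (g : (Fin n → A) →ₗ[A] N) : Prop where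
  map_mulVec : ∀ x, g (D.mulVec x) = 0
  exists_smul_eq_map : ∀ m, ∃ s ∈ S, ∃ x, g x = s • m
  exists_mulVec_eq_smul : ∀ x, g x = 0 → ∃ s ∈ S, ∃ y, D.mulVec y = s • x

namespace IsPresentationAt

variable {S T : Submonoid A} {D : Matrix (Fin n) (Fin n) A} {g : (Fin n → A) →ₗ[A] N}

theorem mono (h : IsPresentationAt S D g) (hST : S ≤ T) : IsPresentationAt T D g where
  map_mulVec := h.map_mulVec
  exists_smul_eq_map m := by
    obtain ⟨s, hs, H⟩ := h.exists_smul_eq_map m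
    exact ⟨s, hST hs, H⟩
  exists_mulVec_eq_smul x hx := by
    obtain ⟨s, hs, H⟩ := h.exists_mulVec_eq_smul x hx
    exact ⟨s, hST hs, H⟩

/-- A presentation at `S` can be composed with a map that is an isomorphism at `S`. -/
theorem comp (h : IsPresentationAt S D g) {E : Type*} [AddCommGroup E] [Module A E]
    (f : N →ₗ[A] E) (hker : ∀ m, f m = 0 → ∃ s ∈ S, s • m = 0)
    (hcoker : ∀ y, ∃ s ∈ S, ∃ m, f m = s • y) : IsPresentationAt S D (f ∘ₗ g) where
  map_mulVec x := by simp [h.map_mulVec]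
  exists_smul_eq_map y := by
    obtain ⟨s, hs, m, hm⟩ := hcoker y
    obtain ⟨r, hr, x, hx⟩ := h.exists_smul_eq_map m
    exact ⟨r * s, S.mul_mem hr hs, x, by simp [hx, hm, mul_smul]⟩
  exists_mulVec_eq_smul x hx := by
    obtain ⟨s, hs, hm⟩ := hker (g x) hx
    obtain ⟨r, hr, y, hy⟩ := h.exists_mulVec_eq_smul (s • x) (by simp [hm])
    exact ⟨r * s, S.mul_mem hr hs, y, by rw [hy, mul_smul]⟩

/-- If the module is torsion then the relation matrix has nonzero determinant. -/
theorem det_ne_zero [IsDomain A] (h : IsPresentationAt S D g) (hS : S ≤ nonZeroDivisors A)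
    (hN : Module.IsTorsion A N) : D.det ≠ 0 := by
  -- A nonzero multiple of each basis vector lies in the image of `D`; collecting them factors a
  -- nonsingular diagonal matrix through `D`.
  have key : ∀ i : Fin n, ∃ a : A, a ≠ 0 ∧ ∃ y, D.mulVec y = a • Pi.single i 1 := by
    intro i
    obtain ⟨⟨b, hb⟩, hb'⟩ := @hN (g (Pi.single i 1))
    obtain ⟨s, hs, y, hy⟩ := h.exists_mulVec_eq_smul (b • Pi.single i 1) (by
      rw [map_smul]; exact hb')
    exact ⟨s * b, nonZeroDivisors.ne_zero (mul_mem (hS hs) hb), y, by rw [hy, mul_smul]⟩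
  choose a ha y hy using key
  have : D * (Matrix.of y).transpose = Matrix.diagonal a := by
    ext i j
    have := congrFun (hy j) i
    simp only [Matrix.mulVec, dotProduct, Pi.smul_apply, smul_eq_mul] at this
    rw [Matrix.mul_apply]
    simp only [Matrix.transpose_apply, Matrix.of_apply, this, Matrix.diagonal_apply,
      Pi.single_apply]
    by_cases hij : i = j <;> simp [hij]
  intro h0
  have h1 := congrArg Matrix.det this
  rw [Matrix.det_mul, h0, zero_mul, Matrix.det_diagonal] at h1
  exact Finset.prod_ne_zero_iff.mpr (fun i _ => ha i) h1.symm

/-- The presentation of the localized module. -/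
theorem nonempty_equiv (h : IsPresentationAt S D g) (R : Type*) [CommRing R] [Algebra A R]
    [IsLocalization S R] {N₁ : Type*} [AddCommGroup N₁] [Module A N₁] [Module R N₁]
    [IsScalarTower A R N₁] (l : N →ₗ[A] N₁) [IsLocalizedModule S l] :
    Nonempty (((Fin n → R) ⧸ LinearMap.range (D.map (algebraMap A R)).toLin') ≃ₗ[R] N₁) := by
  let G : (Fin n → R) →ₗ[R] N₁ := Fintype.linearCombination R fun i => l (g (Pi.single i 1))
  have hG : ∀ x : Fin n → A, G (fun i => algebraMap A R (x i)) = l (g x) := by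
    intro x
    conv_rhs => rw [pi_eq_sum_univ' x]
    simp [G, Fintype.linearCombination_apply]
  have hden : ∀ x : Fin n → R, ∃ s : S, ∃ y : Fin n → A,
      algebraMap A R s • x = fun i => algebraMap A R (y i) := by
    intro x
    obtain ⟨s, hs⟩ := IsLocalization.exist_integer_multiples_of_finite S x
    choose y hy using hs
    exact ⟨s, y, funext fun i => by simp [hy, Algebra.smul_def]⟩
  have hunit : ∀ s : S, IsUnit (algebraMap A R s) := fun s => IsLocalization.map_units R s
  have hD : ∀ y : Fin n → A, (D.map (algebraMap A R)).mulVec (fun i => algebraMap A R (y i)) =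
      fun i => algebraMap A R (D.mulVec y i) := by
    intro y; ext i; simp [Matrix.mulVec, dotProduct]
  have hsurj : Function.Surjective G := by
    intro m
    obtain ⟨⟨m, s⟩, rfl⟩ := IsLocalizedModule.mk'_surjective S l m
    obtain ⟨r, hr, x, hx⟩ := h.exists_smul_eq_map m
    obtain ⟨u, hu⟩ := (hunit (⟨r, hr⟩ * s))
    refine ⟨(↑u⁻¹ : R) • fun i => algebraMap A R (x i), ?_⟩
    rw [map_smul, hG, hx, ← Units.smul_def, inv_smul_eq_iff, Units.smul_def, hu, algebraMap_smul]
    simp only [Function.uncurry_apply_pair, map_smul, Submonoid.coe_mul, mul_smul]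
    rw [← Submonoid.smul_def s, IsLocalizedModule.mk'_cancel']
  have hker : LinearMap.ker G = LinearMap.range (D.map (algebraMap A R)).toLin' := by
    apply le_antisymm
    · intro x hx
      obtain ⟨s, y, hy⟩ := hden x
      have h1 : l (g y) = 0 := by
        rw [← hG, ← hy, map_smul, LinearMap.mem_ker.mp hx, smul_zero]
      obtain ⟨c, hc⟩ := (IsLocalizedModule.eq_zero_iff S l).mp h1
      obtain ⟨r, hr, z, hz⟩ := h.exists_mulVec_eq_smul ((c : A) • y) (by rw [map_smul]; exact hc)
      obtain ⟨u, hu⟩ := (hunit (⟨r, hr⟩ * c * s))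
      refine ⟨(↑u⁻¹ : R) • fun i => algebraMap A R (z i), ?_⟩
      rw [map_smul, Matrix.toLin'_apply, hD, hz, ← Units.smul_def, inv_smul_eq_iff,
        Units.smul_def, hu]
      have hy' := fun i => congrFun hy i
      ext i
      simp only [Pi.smul_apply, smul_eq_mul, map_mul, Submonoid.coe_mul] at hy' ⊢
      rw [← hy']; ring
    · rintro _ ⟨x, rfl⟩
      obtain ⟨s, y, hy⟩ := hden x
      rw [LinearMap.mem_ker, ← (hunit s).smul_eq_zero, ← map_smul, ← map_smul, hy,
        Matrix.toLin'_apply, hD, hG, h.map_mulVec, map_zero]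
  exact ⟨(Submodule.quotEquivOfEq _ _ hker.symm).trans (G.quotKerEquivOfSurjective hsurj)⟩

end IsPresentationAt

end Presentation

/-! ### Localized cyclic modules and determinants -/

section Localization

variable {A : Type*} [CommRing A]

theorem Localization.AtPrime.algebraMap_mem_span_iff [IsDomain A] (p : Ideal A) [p.IsPrime]
    {x d : A} :
    algebraMap A (Localization.AtPrime p) x ∈
      Ideal.span {algebraMap A (Localization.AtPrime p) d} ↔
    ∃ s ∉ p, ∃ y, s * x = d * y := by
  have hinj : Function.Injective (algebraMap A (Localization.AtPrime p)) :=
    IsLocalization.injective _ p.primeCompl_le_nonZeroDivisors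
  rw [Ideal.mem_span_singleton]
  constructor
  · rintro ⟨c, hc⟩
    obtain ⟨⟨y, s⟩, hs⟩ := IsLocalization.surj p.primeCompl c
    refine ⟨s, s.2, y, hinj ?_⟩
    rw [map_mul, map_mul, hc, ← hs]
    ring
  · rintro ⟨s, hs, y, h⟩
    have hu : IsUnit (algebraMap A (Localization.AtPrime p) s) :=
      IsLocalization.map_units (M := p.primeCompl) _ ⟨s, hs⟩
    rw [← hu.dvd_mul_left, ← map_mul, h, map_mul]
    exact dvd_mul_right _ _

/-- The localization of a finite product of cyclic modules. -/
theorem isLocalizedModule_pi_quotient (S : Submonoid A) (R : Type*) [CommRing R] [Algebra A R]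
    [IsLocalization S R] {ι : Type*} [Finite ι] (I : ι → Ideal A) :
    IsLocalizedModule S (LinearMap.pi fun i =>
      (I i).toLocalizedQuotient' R S (Algebra.linearMap A R) ∘ₗ LinearMap.proj i) :=
  inferInstance

/-- The determinant of a presentation of a sum of cyclic modules at a prime whose local ring is a
discrete valuation ring. -/
theorem IsPresentationAt.map_prod_eq_span_det {S : Submonoid A} (R : Type*) [CommRing R]
    [Algebra A R] [IsLocalization S R] [IsDomain R] [IsDiscreteValuationRing R]
    (hinj : Function.Injective (algebraMap A R)) {ι : Type*} [Fintype ι]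
    (I : ι → Ideal A) (hI : ∀ i, I i ≠ ⊥) {n : ℕ} {D : Matrix (Fin n) (Fin n) A}
    {g : (Fin n → A) →ₗ[A] ⨁ i, A ⧸ I i} (h : IsPresentationAt S D g) (hD : D.det ≠ 0) :
    (∏ i, I i).map (algebraMap A R) = Ideal.span {algebraMap A R D.det} := by
  classical
  have h' := h.comp (DirectSum.linearEquivFunOnFintype A ι fun i => A ⧸ I i).toLinearMap
    (fun m hm => ⟨1, S.one_mem, by simpa using hm⟩)
    (fun y => ⟨1, S.one_mem,
      (DirectSum.linearEquivFunOnFintype A ι fun i => A ⧸ I i).symm y, by simp⟩)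
  have := isLocalizedModule_pi_quotient S R I
  obtain ⟨e⟩ := h'.nonempty_equiv R (LinearMap.pi fun i =>
      (I i).toLocalizedQuotient' R S (Algebra.linearMap A R) ∘ₗ LinearMap.proj i)
  have hJ : ∀ i, ∃ a : R, a ≠ 0 ∧
      (I i).localized' R S (Algebra.linearMap A R) = Ideal.span {a} := by
    intro i
    rw [Ideal.localized'_eq_map]
    obtain ⟨a, ha⟩ := (IsPrincipalIdealRing.principal ((I i).map (algebraMap A R))).principal
    refine ⟨a, ?_, ha⟩
    rintro rfl
    refine hI i ((Ideal.map_eq_bot_iff_of_injective hinj).mp ?_)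
    rw [ha]; exact Ideal.span_singleton_eq_bot.mpr rfl
  choose a ha haJ using hJ
  have hdet : (D.map (algebraMap A R)).det = algebraMap A R D.det := by
    rw [RingHom.map_det]; rfl
  have hdet0 : algebraMap A R D.det ≠ 0 := by simpa using hinj.ne hD
  -- The length of the localized module is computed twice: from the determinant, and summand by
  -- summand.
  have hlen := e.length_eq
  rw [length_quotient_range_toLin' _ (hdet ▸ hdet0), hdet, Module.length_pi_of_fintype] at hlen
  have hlen' : Ring.ord R (algebraMap A R D.det) = Ring.ord R (∏ i, a i) := by
    rw [hlen, Ring.ord_prod _ ha]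
    refine Finset.sum_congr rfl fun i _ => ?_
    rw [haJ i]; rfl
  rw [IsDiscreteValuationRing.span_eq_of_ord_eq hdet0
    (Finset.prod_ne_zero_iff.mpr fun i _ => ha i) hlen', ← Ideal.prod_span_singleton]
  refine (map_prod (Ideal.mapHom (algebraMap A R)) I Finset.univ).trans ?_
  refine Finset.prod_congr rfl fun i _ => ?_
  rw [← haJ i, Ideal.localized'_eq_map]
  rfl

end Localization

/-! ### Pseudo-null modules -/

section PseudoNull

variable {A : Type*} [CommRing A] {M : Type*} [AddCommGroup M] [Module A M]

theorem IsPseudoNull.exists_notMem_smul_eq_zero (h : IsPseudoNull A M) (p : HeightOnePrime A) :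
    ∃ s ∉ p.1.asIdeal, ∀ m : M, s • m = 0 := by
  have hle : ¬ Module.annihilator A M ≤ p.1.asIdeal := fun hle => by
    have := h.2.2.trans (Ideal.height_mono hle)
    rw [p.2] at this
    exact absurd this (by norm_num)
  obtain ⟨s, hs, hsp⟩ := SetLike.not_le_iff_exists.mp hle
  exact ⟨s, hsp, fun m => Module.mem_annihilator.mp hs m⟩

theorem Module.IsTorsion.exists_ne_zero_smul_eq_zero [IsDomain A] [Module.Finite A M]
    (h : Module.IsTorsion A M) : ∃ a : A, a ≠ 0 ∧ ∀ m : M, a • m = 0 := by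
  obtain ⟨a, ha, ha'⟩ := Submodule.annihilator_top_inter_nonZeroDivisors h
  exact ⟨a, nonZeroDivisors.ne_zero ha', fun m => Submodule.mem_annihilator.mp ha m trivial⟩

/-- A minimal prime of the annihilator cannot have height zero, as it contains a nonzero element,
nor height one, as it lies in the support. -/
theorem isPseudoNull_of_forall [IsDomain A] [Module.Finite A M]
    (htors : Module.IsTorsion A M)
    (h : ∀ p : HeightOnePrime A, ∀ m : M, ∃ s ∉ p.1.asIdeal, s • m = 0) : IsPseudoNull A M := by
  refine ⟨inferInstance, htors, ?_⟩
  rw [Ideal.height_eq_inf_minimalPrimes]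
  refine le_iInf₂ fun J hJ => ?_
  have := hJ.1.1
  obtain ⟨a, ha, haM⟩ := htors.exists_ne_zero_smul_eq_zero
  have h0 : J.height ≠ 0 := by
    rw [Ne, Ideal.height_eq_zero_iff_eq_bot]
    rintro rfl
    exact ha (hJ.1.2 (Module.mem_annihilator.mpr haM))
  have h1 : J.height ≠ 1 := by
    intro h1
    have hmem : (⟨J, this⟩ : PrimeSpectrum A) ∈ Module.support A M := by
      rw [Module.support_eq_zeroLocus]
      exact hJ.1.2
    exact Module.notMem_support_iff'.mpr (h ⟨⟨J, this⟩, h1⟩) hmem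
  have h1' : 1 < J.height := lt_of_le_of_ne (Order.one_le_iff_ne_zero.mpr h0) h1.symm
  simpa [one_add_one_eq_two] using Order.add_one_le_of_lt h1'

end PseudoNull

/-! ### Divisibility in Krull domains -/

/-- Divisibility in a Krull domain can be tested, up to units at a prime `P`, at the primes of height
one contained in `P`. -/
theorem IsKrullDomain.exists_notMem_mul_eq_mul {A : Type*} [CommRing A] [IsDomain A]
    (hA : IsKrullDomain A) (P : Ideal A) [P.IsPrime] {d x : A} (hd : d ≠ 0)
    (h : ∀ p : HeightOnePrime A, p.1.asIdeal ≤ P → ∃ s ∉ p.1.asIdeal, ∃ y, s * x = d * y) :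
    ∃ s ∉ P, ∃ y, s * x = d * y := by
  classical
  -- If `p` is not below `P`, an element of `p` outside `P`, raised to the valuation of `d` at `p`,
  -- forces divisibility at `p`.
  have key : ∀ p : HeightOnePrime A, ∃ c ∉ P, ∃ r ∉ p.1.asIdeal, ∃ y, r * (c * x) = d * y := by
    intro p
    by_cases hp : p.1.asIdeal ≤ P
    · obtain ⟨s, hs, y, hy⟩ := h p hp
      exact ⟨1, P.ne_top_iff_one.mp Ideal.IsPrime.ne_top', s, hs, y, by rw [one_mul, hy]⟩
    · obtain ⟨c, hcp, hcP⟩ := SetLike.not_le_iff_exists.mp hp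
      have := hA.isDVR p
      let R := Localization.AtPrime p.1.asIdeal
      have hinj : Function.Injective (algebraMap A R) :=
        IsLocalization.injective _ p.1.asIdeal.primeCompl_le_nonZeroDivisors
      obtain ⟨ϖ, hϖ⟩ := IsDiscreteValuationRing.exists_irreducible R
      obtain ⟨k, hk⟩ := IsDiscreteValuationRing.associated_pow_irreducible
        (x := algebraMap A R d) (by simpa using hinj.ne hd) hϖ
      have hc : ϖ ∣ algebraMap A R c := by
        rw [← Ideal.mem_span_singleton, ← hϖ.maximalIdeal_eq]
        exact (IsLocalization.AtPrime.to_map_mem_maximal_iff R p.1.asIdeal c).mpr hcp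
      have hmem : algebraMap A R (c ^ k * x) ∈ Ideal.span {algebraMap A R d} := by
        rw [Ideal.mem_span_singleton, map_mul, map_pow]
        exact (hk.dvd.trans (pow_dvd_pow_of_dvd hc k)).mul_right _
      obtain ⟨r, hr, y, hy⟩ := (Localization.AtPrime.algebraMap_mem_span_iff _).mp hmem
      exact ⟨c ^ k, fun hc' => hcP (Ideal.IsPrime.mem_of_pow_mem ‹_› k hc'), r, hr, y, hy⟩
  choose c hc r hr y hy using key
  -- Only the finitely many `p` containing `d` need correction; elsewhere `d` is a unit.
  let F := (hA.finite_character d hd).toFinset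
  let s := ∏ p ∈ F, c p
  have hs : s ∉ P := by
    intro hs
    obtain ⟨p, -, hp⟩ := (Ideal.IsPrime.prod_mem_iff).mp hs
    exact hc p hp
  let K := FractionRing A
  have hdK : algebraMap A K d ≠ 0 := by simpa using hd
  obtain ⟨a, ha⟩ := hA.eq_inter (algebraMap A K (s * x) / algebraMap A K d) fun p => by
    by_cases hp : p ∈ F
    · refine ⟨(∏ q ∈ F.erase p, c q) * y p, r p, hr p, ?_⟩
      rw [div_mul_eq_mul_div, div_eq_iff hdK, ← map_mul, ← map_mul]
      congr 1
      have : s = c p * ∏ q ∈ F.erase p, c q := (Finset.mul_prod_erase F c hp).symm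
      rw [this]
      linear_combination (∏ q ∈ F.erase p, c q) * hy p
    · refine ⟨s * x, d, fun hdp => hp (by simpa [F] using hdp), ?_⟩
      rw [div_mul_cancel₀ _ hdK]
  refine ⟨s, hs, a, ?_⟩
  apply IsFractionRing.injective A K
  rw [eq_div_iff hdK] at ha
  rw [← ha, ← map_mul, mul_comm]

/-! ### The structure theorem up to pseudo-isomorphism -/

section Structure

variable {A : Type u} [CommRing A] [IsDomain A] [IsNoetherianRing A]
  {M : Type v} [AddCommGroup M] [Module A M] [Module.Finite A M]

/-- A map of torsion modules that is an isomorphism at all primes of height one is a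
pseudo-isomorphism. -/
theorem isPseudoIso_of_forall {E : Type*} [AddCommGroup E] [Module A E] [Module.Finite A E]
    (f : M →ₗ[A] E) (hM : Module.IsTorsion A M) (hE : Module.IsTorsion A E)
    (hker : ∀ q : HeightOnePrime A, ∀ m, f m = 0 → ∃ s ∉ q.1.asIdeal, s • m = 0)
    (hcoker : ∀ q : HeightOnePrime A, ∀ y, ∃ s ∉ q.1.asIdeal, ∃ m, f m = s • y) :
    IsPseudoIso f := by
  refine ⟨isPseudoNull_of_forall ?_ ?_, isPseudoNull_of_forall ?_ ?_⟩
  · intro m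
    obtain ⟨b, hb⟩ := @hM m.1
    exact ⟨b, Subtype.ext hb⟩
  · rintro q ⟨m, hm⟩
    obtain ⟨s, hs, hsm⟩ := hker q m hm
    exact ⟨s, hs, Subtype.ext hsm⟩
  · intro y
    obtain ⟨y, rfl⟩ := Submodule.Quotient.mk_surjective _ y
    obtain ⟨b, hb⟩ := @hE y
    refine ⟨b, ?_⟩
    rw [Submonoid.smul_def] at hb ⊢
    rw [← Submodule.Quotient.mk_smul, hb, Submodule.Quotient.mk_zero]
  · intro q y
    obtain ⟨y, rfl⟩ := Submodule.Quotient.mk_surjective _ y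
    obtain ⟨s, hs, m, hm⟩ := hcoker q y
    refine ⟨s, hs, ?_⟩
    rw [← Submodule.Quotient.mk_smul, Submodule.Quotient.mk_eq_zero]
    exact ⟨m, hm⟩

/-- A torsion module admits, for every height one prime `q`, a map to a sum of modules `A ⧸ q ^ e`
that is an isomorphism at `q`. -/
theorem IsKrullDomain.exists_map_pi_quotient_pow (hA : IsKrullDomain A)
    (htors : Module.IsTorsion A M) (q : HeightOnePrime A) :
    ∃ (ι : Type u) (_ : Fintype ι) (e : ι → ℕ) (f : M →ₗ[A] ∀ i, A ⧸ q.1.asIdeal ^ e i),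
      (∀ m, f m = 0 → ∃ s ∉ q.1.asIdeal, s • m = 0) ∧
      ∀ y, ∃ s ∉ q.1.asIdeal, ∃ m, f m = s • y := by
  let S := q.1.asIdeal.primeCompl
  let R := Localization.AtPrime q.1.asIdeal
  have hR : IsDiscreteValuationRing R := hA.isDVR q
  have hinj : Function.Injective (algebraMap A R) :=
    IsLocalization.injective _ q.1.asIdeal.primeCompl_le_nonZeroDivisors
  let μ := LocalizedModule.mkLinearMap S M
  have htors' : Module.IsTorsion R (LocalizedModule S M) := by
    intro z
    obtain ⟨⟨m, s⟩, rfl⟩ := IsLocalizedModule.mk'_surjective S μ z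
    obtain ⟨⟨a, ha⟩, ham⟩ := @htors m
    refine ⟨⟨algebraMap A R a, mem_nonZeroDivisors_of_ne_zero ?_⟩, ?_⟩
    · simpa using hinj.ne (nonZeroDivisors.ne_zero ha)
    · rw [Submonoid.mk_smul]
      replace ham : a • m = 0 := ham
      rw [algebraMap_smul, Function.uncurry_apply_pair, ← IsLocalizedModule.mk'_smul, ham,
        IsLocalizedModule.mk'_zero]
  obtain ⟨ι, _, ϖ, hϖ, e, ⟨E⟩⟩ := Module.equiv_directSum_of_isTorsion htors'
  classical
  have hJ : ∀ i, Submodule.span R {ϖ i ^ e i} =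
      (q.1.asIdeal ^ e i).localized' R S (Algebra.linearMap A R) := by
    intro i
    rw [Ideal.localized'_eq_map, Ideal.map_pow, Localization.AtPrime.map_eq_maximalIdeal,
      (hϖ i).maximalIdeal_eq, Ideal.span_singleton_pow]
  have E' : LocalizedModule S M ≃ₗ[R]
      (∀ i, R ⧸ (q.1.asIdeal ^ e i).localized' R S (Algebra.linearMap A R)) :=
    E.trans ((DirectSum.linearEquivFunOnFintype R ι _).trans
      (LinearEquiv.piCongrRight fun i => Submodule.quotEquivOfEq _ _ (hJ i)))
  let l : (∀ i, A ⧸ q.1.asIdeal ^ e i) →ₗ[A]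
      ∀ i, R ⧸ (q.1.asIdeal ^ e i).localized' R S (Algebra.linearMap A R) :=
    LinearMap.pi fun i =>
      (q.1.asIdeal ^ e i).toLocalizedQuotient' R S (Algebra.linearMap A R) ∘ₗ LinearMap.proj i
  have : IsLocalizedModule S l :=
    isLocalizedModule_pi_quotient S R fun i => q.1.asIdeal ^ e i
  have : Module.FinitePresentation A M := Module.finitePresentation_of_finite A M
  -- By finite presentation, the isomorphism over the discrete valuation ring descends to `A` after
  -- multiplication by a denominator `s`.
  obtain ⟨f, s, hf⟩ := Module.FinitePresentation.exists_lift_of_isLocalizedModule S l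
    ((E'.restrictScalars A).toLinearMap ∘ₗ μ)
  have hf' : ∀ m, l (f m) = E' (μ ((s : A) • m)) := by
    intro m
    have := LinearMap.congr_fun hf m
    rw [LinearMap.comp_apply] at this
    rw [this, ← LinearEquiv.restrictScalars_apply A E', map_smul, map_smul]
    rfl
  refine ⟨ι, inferInstance, e, f, ?_, ?_⟩
  · intro m hm
    have h1 : μ ((s : A) • m) = 0 := by
      have := hf' m
      rwa [hm, map_zero, eq_comm, E'.map_eq_zero_iff] at this
    obtain ⟨c, hc⟩ := (IsLocalizedModule.eq_zero_iff S μ).mp h1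
    exact ⟨c * s, (c * s).2, by rw [mul_smul]; exact hc⟩
  · intro y
    obtain ⟨⟨m, t⟩, hm⟩ := IsLocalizedModule.mk'_surjective S μ (E'.symm (l y))
    have h1 : (t : A) • l y = E' (μ m) := by
      rw [← IsLocalizedModule.mk'_cancel' (S := S) μ m t, Submonoid.smul_def,
        ← LinearEquiv.restrictScalars_apply A E', map_smul]
      simp only [Function.uncurry_apply_pair] at hm
      rw [hm, LinearEquiv.restrictScalars_apply, LinearEquiv.apply_symm_apply]
    have h2 : l (f m) = l ((s * t : A) • y) := by
      rw [hf', map_smul, mul_smul, map_smul l, map_smul l, h1,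
        ← LinearEquiv.restrictScalars_apply A E', map_smul]
      rfl
    obtain ⟨c, hc⟩ := IsLocalizedModule.exists_of_eq (S := S) h2
    refine ⟨c * (s * t), (c * (s * t)).2, (c : A) • m, ?_⟩
    rw [map_smul, mul_smul]
    exact hc

/-- The structure theorem for finitely generated torsion modules over a noetherian Krull domain. -/
theorem IsKrullDomain.exists_isPseudoIso (hA : IsKrullDomain A) (htors : Module.IsTorsion A M) :
    ∃ (n : ℕ) (p : Fin n → HeightOnePrime A) (e : Fin n → ℕ)
      (f : M →ₗ[A] ⨁ i : Fin n, A ⧸ (p i).1.asIdeal ^ e i), IsPseudoIso f := by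
  classical
  obtain ⟨a, ha, haM⟩ := htors.exists_ne_zero_smul_eq_zero
  -- `M` vanishes at every height one prime not containing the annihilating element `a`, so
  -- combining the local maps at finitely many primes suffices.
  let F := (hA.finite_character a ha).toFinset
  have hF : ∀ q, q ∉ F → a ∉ q.1.asIdeal := fun q hq hqa => hq (by simpa [F] using hqa)
  choose ι _ e f hker hcoker using fun q => hA.exists_map_pi_quotient_pow htors q
  let σ := Σ q : F, ι q
  let Q : σ → Ideal A := fun x => x.1.1.1.asIdeal ^ e x.1 x.2
  let fσ : M →ₗ[A] ∀ x : σ, A ⧸ Q x := LinearMap.pi fun x => LinearMap.proj x.2 ∘ₗ f x.1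
  have hkerσ : ∀ q : HeightOnePrime A, ∀ m, fσ m = 0 → ∃ s ∉ q.1.asIdeal, s • m = 0 := by
    intro q m hm
    by_cases hq : q ∈ F
    · exact hker q m (funext fun j => congrFun hm ⟨⟨q, hq⟩, j⟩)
    · exact ⟨a, hF q hq, haM m⟩
  have hcokerσ : ∀ q : HeightOnePrime A, ∀ y, ∃ s ∉ q.1.asIdeal, ∃ m, fσ m = s • y := by
    intro q y
    have h1 : ∃ s ∉ q.1.asIdeal, ∃ m, ∀ x : σ, x.1.1 = q → fσ m x = s • y x := by
      by_cases hq : q ∈ F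
      · obtain ⟨s, hs, m, hm⟩ := hcoker q fun j => y ⟨⟨q, hq⟩, j⟩
        refine ⟨s, hs, m, ?_⟩
        rintro ⟨⟨q', hq'⟩, j⟩ rfl
        exact congrFun hm j
      · refine ⟨1, q.1.asIdeal.ne_top_iff_one.mp Ideal.IsPrime.ne_top', 0, ?_⟩
        rintro ⟨⟨q', hq'⟩, j⟩ rfl
        exact absurd hq' hq
    -- Distinct height one primes are incomparable, so the summands at other primes are killed by
    -- elements outside `q`.
    have h2 : ∀ x : σ, ∃ c ∉ q.1.asIdeal, x.1.1 ≠ q → c ∈ Q x := by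
      intro x
      by_cases hx : x.1.1 = q
      · exact ⟨1, q.1.asIdeal.ne_top_iff_one.mp Ideal.IsPrime.ne_top', fun h => absurd hx h⟩
      · have hle : ¬ x.1.1.1.asIdeal ≤ q.1.asIdeal := by
          intro hle
          have : x.1.1.1.asIdeal.FiniteHeight :=
            ⟨Or.inr (by rw [x.1.1.2]; exact ENat.one_ne_top)⟩
          exact hx (Subtype.ext (PrimeSpectrum.ext
            (Ideal.eq_of_le_of_height_le _ hle (by rw [q.2, x.1.1.2]))))
        obtain ⟨c, hc, hcq⟩ := SetLike.not_le_iff_exists.mp hle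
        exact ⟨c ^ e x.1 x.2, fun h => hcq (Ideal.IsPrime.mem_of_pow_mem q.1.2 _ h),
          fun _ => Ideal.pow_mem_pow hc _⟩
    obtain ⟨s, hs, m, hm⟩ := h1
    choose c hc hcQ using h2
    let C := ∏ x, c x
    have hC : C ∉ q.1.asIdeal := by
      intro h
      obtain ⟨x, -, hx⟩ := (Ideal.IsPrime.prod_mem_iff).mp h
      exact hc x hx
    refine ⟨C * s, fun h => (Ideal.IsPrime.mem_or_mem q.1.2 h).elim hC hs, C • m, ?_⟩
    ext x
    rw [map_smul, Pi.smul_apply, Pi.smul_apply, mul_smul]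
    by_cases hx : x.1.1 = q
    · rw [hm x hx]
    · have hCx : C ∈ Q x := Ideal.mem_of_dvd _ (Finset.dvd_prod_of_mem c (Finset.mem_univ x))
        (hcQ x hx)
      have hz : ∀ z : A ⧸ Q x, C • z = 0 := by
        intro z
        obtain ⟨z, rfl⟩ := Submodule.Quotient.mk_surjective _ z
        rw [← Submodule.Quotient.mk_smul, Submodule.Quotient.mk_eq_zero]
        exact Ideal.mul_mem_right _ _ hCx
      rw [hz, hz]
  have htorsσ : Module.IsTorsion A (∀ x : σ, A ⧸ Q x) := by
    intro y
    have h1 : ∀ x : σ, ∃ b ≠ 0, b ∈ Q x := by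
      intro x
      have : Q x ≠ ⊥ := pow_ne_zero _ (Ideal.ne_bot_of_height_eq_one x.1.1.2)
      obtain ⟨b, hb, hb0⟩ := Submodule.exists_mem_ne_zero_of_ne_bot this
      exact ⟨b, hb0, hb⟩
    choose b hb hbQ using h1
    refine ⟨⟨∏ x, b x, mem_nonZeroDivisors_of_ne_zero
      (Finset.prod_ne_zero_iff.mpr fun x _ => hb x)⟩, ?_⟩
    ext x
    change (∏ x, b x) • y x = 0
    obtain ⟨z, hz⟩ := Submodule.Quotient.mk_surjective _ (y x)
    rw [← hz, ← Submodule.Quotient.mk_smul, Submodule.Quotient.mk_eq_zero]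
    exact Ideal.mul_mem_right _ _ (Ideal.mem_of_dvd _
      (Finset.dvd_prod_of_mem b (Finset.mem_univ x)) (hbQ x))
  let r := (Fintype.equivFin σ).symm
  let Φ : (∀ x : σ, A ⧸ Q x) ≃ₗ[A] ⨁ i, A ⧸ Q (r i) :=
    (LinearEquiv.piCongrLeft A (fun x => A ⧸ Q x) r).symm.trans
      (DirectSum.linearEquivFunOnFintype A _ _).symm
  refine ⟨Fintype.card σ, fun i => (r i).1.1, fun i => e (r i).1 (r i).2,
    Φ.toLinearMap ∘ₗ fσ, isPseudoIso_of_forall _ htors ?_ ?_ ?_⟩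
  · intro y
    obtain ⟨y, rfl⟩ := Φ.surjective y
    obtain ⟨b, hb⟩ := @htorsσ y
    refine ⟨b, ?_⟩
    rw [Submonoid.smul_def] at hb ⊢
    rw [← map_smul, hb, map_zero]
  · intro q m hm
    exact hkerσ q m (Φ.map_eq_zero_iff.mp hm)
  · intro q y
    obtain ⟨y, rfl⟩ := Φ.surjective y
    obtain ⟨s, hs, m, hm⟩ := hcokerσ q y
    refine ⟨s, hs, m, ?_⟩
    rw [LinearMap.comp_apply, hm, map_smul]
    rfl

theorem IsKrullDomain.isCharIdeal_charIdeal (hA : IsKrullDomain A) :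
    IsCharIdeal A M (charIdeal A M) := by
  have h : ∃ I : Ideal A, IsCharIdeal A M I := by
    by_cases htors : Module.IsTorsion A M
    · obtain ⟨n, p, e, f, hf⟩ := hA.exists_isPseudoIso htors
      exact ⟨_, Or.inr ⟨htors, n, p, e, f, hf, rfl⟩⟩
    · exact ⟨⊥, Or.inl ⟨htors, rfl⟩⟩
  rw [charIdeal, dif_pos h]
  exact h.choose_spec

end Structure

/-! ### Characteristic ideals through presentations -/

/-- The characteristic ideal of a torsion module is locally generated by the determinant of any
square presentation. -/
theorem IsCharIdeal.exists_eq_divisorialHull {A : Type u} [CommRing A] [IsDomain A]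
    (hA : IsKrullDomain A) {M : Type v} [AddCommGroup M] [Module A M] {I : Ideal A}
    (hI : IsCharIdeal A M I) (htors : Module.IsTorsion A M) :
    ∃ J : Ideal A, I = divisorialHull J ∧
      ∀ (p : HeightOnePrime A) (n : ℕ) (D : Matrix (Fin n) (Fin n) A) (g : (Fin n → A) →ₗ[A] M),
        IsPresentationAt p.1.asIdeal.primeCompl D g → D.det ≠ 0 →
        J.map (algebraMap A (Localization.AtPrime p.1.asIdeal)) =
          Ideal.span {algebraMap A (Localization.AtPrime p.1.asIdeal) D.det} := by
  obtain ⟨h, -⟩ | ⟨-, n, q, e, f, hf, rfl⟩ := hI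
  · exact absurd htors h
  refine ⟨_, rfl, fun p k D g hg hD => ?_⟩
  have := hA.isDVR p
  have hfg : IsPresentationAt p.1.asIdeal.primeCompl D (f ∘ₗ g) := by
    refine hg.comp f (fun m hm => ?_) fun y => ?_
    · obtain ⟨s, hs, hs'⟩ := hf.1.exists_notMem_smul_eq_zero p
      exact ⟨s, hs, congrArg Subtype.val (hs' ⟨m, hm⟩)⟩
    · obtain ⟨s, hs, hs'⟩ := hf.2.exists_notMem_smul_eq_zero p
      have h := hs' (Submodule.Quotient.mk y)
      rw [← Submodule.Quotient.mk_smul, Submodule.Quotient.mk_eq_zero] at h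
      obtain ⟨m, hm⟩ := h
      exact ⟨s, hs, m, hm⟩
  exact hfg.map_prod_eq_span_det _
    (IsLocalization.injective _ p.1.asIdeal.primeCompl_le_nonZeroDivisors)
    (fun i => (q i).1.asIdeal ^ e i)
    (fun i => pow_ne_zero _ (Ideal.ne_bot_of_height_eq_one (q i).2)) hD

/-- A form of Nakayama's lemma at a prime. -/
theorem Module.exists_notMem_smul_eq_zero_of_smul_eq_smul {A : Type*} [CommRing A] {K : Type*}
    [AddCommGroup K] [Module A K] [Module.Finite A K] (P : Ideal A) [hP : P.IsPrime] {t : A}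
    (ht : t ∈ P) (h : ∀ k : K, ∃ s ∉ P, ∃ k' : K, s • k = t • k') (k : K) :
    ∃ s ∉ P, s • k = 0 := by
  by_contra! hk
  have hmem : (⟨P, hP⟩ : PrimeSpectrum A) ∈ Module.support A K := by
    rw [Module.mem_support_iff']
    exact ⟨k, hk⟩
  -- The support of `K/tK` is that of `K` cut by `V(t)`, while the hypothesis says that `K/tK`
  -- vanishes at `P`.
  have hmem' : (⟨P, hP⟩ : PrimeSpectrum A) ∈ Module.support A (QuotSMulTop t K) := by
    rw [Module.support_quotSMulTop]
    exact ⟨hmem, by simpa using ht⟩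
  refine Module.notMem_support_iff'.mpr (fun z => ?_) hmem'
  obtain ⟨z, rfl⟩ := Submodule.Quotient.mk_surjective _ z
  obtain ⟨s, hs, k', hk'⟩ := h z
  refine ⟨s, hs, ?_⟩
  rw [← Submodule.Quotient.mk_smul, Submodule.Quotient.mk_eq_zero, hk']
  exact Submodule.smul_mem_pointwise_smul _ _ _ trivial

/-! ### Reduction modulo `t` -/

section Descent

variable {A B : Type*} [CommRing A] [CommRing B] {φ : A →+* B} {t : A}
  {N : Type*} [AddCommGroup N] [Module A N]

/-- If `φ : A → B` is surjective with kernel `(t)`, the local ring of `B` at `q` is a principal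
ideal domain and the `t`-torsion of `N` vanishes at `φ⁻¹ q`, then `N` has a square presentation at
`φ⁻¹ q`. -/
theorem exists_isPresentationAt_comap [IsNoetherianRing A] [IsDomain B]
    (hφ : Function.Surjective φ) (hker : RingHom.ker φ = Ideal.span {t}) [Module.Finite A N]
    (q : Ideal B) [q.IsPrime] [IsPrincipalIdealRing (Localization.AtPrime q)]
    (hN : ∃ s, φ s ∉ q ∧ ∀ m : N, t • m = 0 → s • m = 0) :
    ∃ (n : ℕ) (D : Matrix (Fin n) (Fin n) A) (g : (Fin n → A) →ₗ[A] N),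
      IsPresentationAt (q.comap φ).primeCompl D g := by
  obtain ⟨n, g, hg⟩ := Module.Finite.exists_fin' A N
  let R := Localization.AtPrime q
  have hinj : Function.Injective (algebraMap B R) :=
    IsLocalization.injective _ q.primeCompl_le_nonZeroDivisors
  have hunit : ∀ s, φ s ∉ q → IsUnit (algebraMap B R (φ s)) := fun s hs =>
    IsLocalization.map_units (M := q.primeCompl) R ⟨φ s, hs⟩
  let χ : A →+* R := (algebraMap B R).comp φ
  let τ : (Fin n → A) →ₛₗ[χ] (Fin n → R) :=
    { toFun := fun x i => χ (x i)
      map_add' := fun x y => by ext; simp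
      map_smul' := fun a x => by ext; simp }
  have hτ : ∀ x, τ x = 0 → ∃ y, x = t • y := by
    intro x hx
    have : ∀ i, ∃ c, x i = t * c := by
      intro i
      have h1 : algebraMap B R (φ (x i)) = 0 := congrFun hx i
      rw [map_eq_zero_iff _ hinj, ← RingHom.mem_ker, hker, Ideal.mem_span_singleton] at h1
      exact h1
    choose y hy using this
    exact ⟨y, funext hy⟩
  have hspan : ∀ (L : Submodule A (Fin n → A)) (z : Fin n → R),
      z ∈ Submodule.span R (τ '' L) → ∃ s, φ s ∉ q ∧ ∃ x ∈ L, χ s • z = τ x := by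
    intro L z hz
    induction hz using Submodule.span_induction with
    | mem z hz =>
      obtain ⟨x, hx, rfl⟩ := hz
      exact ⟨1, by simpa using q.ne_top_iff_one.mp Ideal.IsPrime.ne_top', x, hx, by simp⟩
    | zero => exact ⟨1, by simpa using q.ne_top_iff_one.mp Ideal.IsPrime.ne_top', 0, zero_mem _,
        by simp⟩
    | add z w _ _ hz hw =>
      obtain ⟨s, hs, x, hx, hsx⟩ := hz
      obtain ⟨r, hr, y, hy, hry⟩ := hw
      refine ⟨s * r, fun h => (Ideal.IsPrime.mem_or_mem ‹_› (map_mul φ s r ▸ h)).elim hs hr,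
        r • x + s • y, add_mem (L.smul_mem _ hx) (L.smul_mem _ hy), ?_⟩
      rw [map_add, LinearMap.map_smulₛₗ, LinearMap.map_smulₛₗ, ← hsx, ← hry, map_mul, smul_add,
        smul_smul, smul_smul, mul_comm (χ r)]
    | smul c z _ hz =>
      obtain ⟨s, hs, x, hx, hsx⟩ := hz
      obtain ⟨⟨b, r⟩, hbr⟩ := IsLocalization.surj q.primeCompl c
      obtain ⟨a, rfl⟩ := hφ b
      obtain ⟨r', hr'⟩ := hφ r
      refine ⟨r' * s, fun h => (Ideal.IsPrime.mem_or_mem ‹_› (map_mul φ r' s ▸ h)).elim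
        (by rw [hr']; exact r.2) hs, a • x, L.smul_mem _ hx, ?_⟩
      have hc : c * χ r' = χ a := by
        simpa only [χ, RingHom.comp_apply, hr'] using hbr
      rw [LinearMap.map_smulₛₗ, ← hsx, ← hc, map_mul, smul_smul, smul_smul]
      congr 1
      ring
  let K := LinearMap.ker g
  -- Only the basis `snf.bN` and the embedding `snf.f` of its index set into `Fin n` are used, not
  -- the diagonal coefficients.
  obtain ⟨m, snf⟩ := (Submodule.span R (τ '' K)).smithNormalForm (Pi.basisFun R (Fin n))
  choose s hs x hxK hsx using fun i => hspan K (snf.bN i) (snf.bN i).2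
  -- Zero columns fill the places missed by `snf.f`, which makes `D` square.
  let k : Fin n → (Fin n → A) := Function.extend snf.f x 0
  have hk : ∀ j, k j ∈ K := by
    intro j
    by_cases hj : ∃ i, snf.f i = j
    · obtain ⟨i, rfl⟩ := hj
      simpa only [k, snf.f.injective.extend_apply] using hxK i
    · simp only [k, Function.extend_apply' _ _ _ hj]
      exact zero_mem K
  let D : Matrix (Fin n) (Fin n) A := (Matrix.of k).transpose
  have hD : ∀ y, D.mulVec y = ∑ j, y j • k j := by
    intro y
    ext i
    simp [D, Matrix.mulVec, dotProduct, mul_comm]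
  have hDK : LinearMap.range D.toLin' ≤ K := by
    rintro _ ⟨y, rfl⟩
    rw [Matrix.toLin'_apply, hD]
    exact Submodule.sum_mem _ fun j _ => K.smul_mem _ (hk j)
  have hDspan : Submodule.span R (τ '' K) ≤
      Submodule.span R (τ '' LinearMap.range D.toLin') := by
    have h1 : ∀ i, (snf.bN i : Fin n → R) ∈ Submodule.span R (τ '' LinearMap.range D.toLin') := by
      intro i
      obtain ⟨u, hu⟩ := hunit (s i) (hs i)
      have h2 : (snf.bN i : Fin n → R) = (↑u⁻¹ : R) • τ (x i) := by
        rw [← hsx i, ← Units.smul_def, eq_inv_smul_iff, Units.smul_def, hu]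
        rfl
      rw [h2]
      refine Submodule.smul_mem _ _ (Submodule.subset_span ⟨x i, ⟨Pi.single (snf.f i) 1, ?_⟩, rfl⟩)
      rw [Matrix.toLin'_apply, hD, Finset.sum_eq_single (snf.f i)]
      · simp [k, snf.f.injective.extend_apply]
      · intro j _ hj
        rw [Pi.single_eq_of_ne hj, zero_smul]
      · simp
    intro z hz
    have h3 := snf.bN.sum_repr ⟨z, hz⟩
    have h4 : _ = z := congrArg Subtype.val h3
    rw [← h4, Submodule.coe_sum]
    exact Submodule.sum_mem _ fun i _ => Submodule.smul_mem _ _ (h1 i)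
  obtain ⟨s', hs', hs'N⟩ := hN
  have ht : φ t = 0 := by
    rw [← RingHom.mem_ker, hker]
    exact Ideal.mem_span_singleton_self t
  refine ⟨n, D, g, ⟨fun y => ?_, fun m => ?_, fun y hy => ?_⟩⟩
  · exact hDK ⟨y, Matrix.toLin'_apply D y⟩
  · obtain ⟨y, rfl⟩ := hg m
    exact ⟨1, Submonoid.one_mem _, y, by simp⟩
  · let L : Submodule A K := (LinearMap.range D.toLin').comap K.subtype
    have key := Module.exists_notMem_smul_eq_zero_of_smul_eq_smul (K := K ⧸ L) (q.comap φ)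
      (t := t) (by simp [ht]) (fun z => by
        obtain ⟨⟨z, hz⟩, rfl⟩ := Submodule.Quotient.mk_surjective _ z
        obtain ⟨r, hr, w, hw, hrw⟩ :=
          hspan _ _ (hDspan (Submodule.subset_span (Set.mem_image_of_mem τ hz)))
        rw [← LinearMap.map_smulₛₗ] at hrw
        obtain ⟨v, hv⟩ := hτ (r • z - w) (by rw [map_sub, hrw, sub_self])
        -- Here the torsion hypothesis enters: `t • v ∈ K` gives `s' • v ∈ K`, so `K ∩ tAⁿ = tK` at
        -- the prime, as Nakayama requires.
        have hv0 : t • g v = 0 := by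
          rw [← map_smul, ← hv]
          exact sub_mem (K.smul_mem r hz) (hDK hw)
        have hvK : s' • v ∈ K := by
          rw [LinearMap.mem_ker, map_smul, hs'N _ hv0]
        refine ⟨s' * r, fun h => (Ideal.IsPrime.mem_or_mem ‹q.IsPrime›
          (map_mul φ s' r ▸ Ideal.mem_comap.mp h)).elim hs' hr,
          Submodule.Quotient.mk ⟨s' • v, hvK⟩, ?_⟩
        rw [← Submodule.Quotient.mk_smul, ← Submodule.Quotient.mk_smul, Submodule.Quotient.eq]
        have h5 : (s' * r) • z - t • (s' • v) = s' • w := by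
          rw [smul_comm t s', ← hv, mul_smul, smul_sub, sub_sub_cancel]
        change (s' * r) • z - t • (s' • v) ∈ LinearMap.range D.toLin'
        rw [h5]
        exact Submodule.smul_mem _ _ hw) (Submodule.Quotient.mk ⟨y, hy⟩)
    obtain ⟨r, hr, hry⟩ := key
    rw [← Submodule.Quotient.mk_smul, Submodule.Quotient.mk_eq_zero] at hry
    obtain ⟨z, hz⟩ := hry
    exact ⟨r, hr, z, by rw [← Matrix.toLin'_apply, hz]; rfl⟩

variable {N₁ : Type*} [AddCommGroup N₁] [Module B N₁]

/-- A presentation of `N` induces a presentation of its reduction modulo `t`. -/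
theorem IsPresentationAt.exists_descend (hφ : Function.Surjective φ) (hφt : φ t = 0)
    (ν : N →ₛₗ[φ] N₁) (hν : Function.Surjective ν) (hνker : ∀ m, ν m = 0 → ∃ m', m = t • m')
    (q : Ideal B) [q.IsPrime] {n : ℕ} {D : Matrix (Fin n) (Fin n) A}
    {g : (Fin n → A) →ₗ[A] N} (h : IsPresentationAt (q.comap φ).primeCompl D g) :
    ∃ g' : (Fin n → B) →ₗ[B] N₁, IsPresentationAt q.primeCompl (D.map φ) g' := by
  let g' : (Fin n → B) →ₗ[B] N₁ := Fintype.linearCombination B fun i => ν (g (Pi.single i 1))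
  have hg' : ∀ x : Fin n → A, g' (fun i => φ (x i)) = ν (g x) := by
    intro x
    conv_rhs => rw [pi_eq_sum_univ' x]
    simp [g', Fintype.linearCombination_apply]
  have hD : ∀ y : Fin n → A, (D.map φ).mulVec (fun i => φ (y i)) =
      fun i => φ (D.mulVec y i) := by
    intro y; ext i; simp [Matrix.mulVec, dotProduct]
  have hlift : ∀ x : Fin n → B, ∃ y : Fin n → A, x = fun i => φ (y i) := by
    intro x
    choose y hy using fun i => hφ (x i)
    exact ⟨y, funext fun i => (hy i).symm⟩
  refine ⟨g', ⟨fun x => ?_, fun m => ?_, fun x hx => ?_⟩⟩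
  · obtain ⟨y, rfl⟩ := hlift x
    rw [hD, hg', h.map_mulVec, map_zero]
  · obtain ⟨m, rfl⟩ := hν m
    obtain ⟨s, hs, x, hx⟩ := h.exists_smul_eq_map m
    exact ⟨φ s, hs, fun i => φ (x i), by rw [hg', hx, LinearMap.map_smulₛₗ]⟩
  · obtain ⟨y, rfl⟩ := hlift x
    rw [hg'] at hx
    obtain ⟨m, hm⟩ := hνker _ hx
    obtain ⟨s, hs, z, hz⟩ := h.exists_smul_eq_map m
    -- Since `g y = t • m` and `g z = s • m`, this difference is a relation of `N`; its `t`-part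
    -- disappears under `φ`.
    obtain ⟨r, hr, w, hw⟩ := h.exists_mulVec_eq_smul (s • y - t • z) (by
      rw [map_sub, map_smul, map_smul, hm, hz, smul_comm, sub_self])
    refine ⟨φ (r * s), Submonoid.mul_mem (q.comap φ).primeCompl hr hs, fun i => φ (w i), ?_⟩
    rw [hD, hw]
    ext i
    simp [hφt, mul_assoc]

/-- If a torsion module has no `t`-torsion at `(t)`, then it is killed by an element outside `(t)`. -/
theorem exists_notMem_span_smul_eq_zero [IsDomain A] [IsNoetherianRing A] [Module.Finite A N]
    (hN : Module.IsTorsion A N) (hprime : (Ideal.span {t}).IsPrime)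
    {s : A} (hs : s ∉ Ideal.span {t}) (hsN : ∀ m : N, t • m = 0 → s • m = 0) :
    ∃ a ∉ Ideal.span {t}, ∀ m : N, a • m = 0 := by
  obtain ⟨a, ha, haN⟩ := hN.exists_ne_zero_smul_eq_zero
  have htu : ¬ IsUnit t := fun h => hprime.ne_top (Ideal.span_singleton_eq_top.mpr h)
  -- With all powers of `t` split off the annihilating element, `s ^ k` takes over the role of `t ^
  -- k`.
  obtain ⟨k, b, hb, rfl⟩ := WfDvdMonoid.max_power_factor' ha htu
  rw [← Ideal.mem_span_singleton] at hb
  have key : ∀ (j : ℕ) (m : N), t ^ j • m = 0 → s ^ j • m = 0 := by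
    intro j
    induction j with
    | zero => intro m hm; simpa using hm
    | succ j ih =>
      intro m hm
      have h1 : t • t ^ j • m = 0 := by rw [smul_smul, ← pow_succ']; exact hm
      have h2 := hsN _ h1
      rw [smul_comm] at h2
      have h3 := ih _ h2
      rwa [smul_smul, ← pow_succ] at h3
  refine ⟨s ^ k * b, fun h => (hprime.mem_or_mem h).elim
    (fun h => hs (hprime.mem_of_pow_mem _ h)) hb, fun m => ?_⟩
  rw [mul_smul]
  exact key k _ (by rw [smul_smul]; exact haN m)

end Descent

/-- The image of the characteristic ideal of `N` modulo `t` lies in the characteristic ideal of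
`N ⧸ t N`, provided that the `t`-torsion of `N` vanishes generically and in codimension one. -/
theorem map_charIdeal_mem {A : Type u} {B : Type v} [CommRing A] [CommRing B] [IsDomain A]
    [IsDomain B] [IsNoetherianRing A] [IsNoetherianRing B] (hA : IsKrullDomain A)
    (hB : IsKrullDomain B) {φ : A →+* B} (hφ : Function.Surjective φ) {t : A}
    (hker : RingHom.ker φ = Ideal.span {t})
    {N : Type*} [AddCommGroup N] [Module A N] [Module.Finite A N]
    {N₁ : Type*} [AddCommGroup N₁] [Module B N₁] [Module.Finite B N₁]
    (ν : N →ₛₗ[φ] N₁) (hν : Function.Surjective ν) (hνker : ∀ m, ν m = 0 → ∃ m', m = t • m')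
    (hgen : ∃ s, φ s ≠ 0 ∧ ∀ m : N, t • m = 0 → s • m = 0)
    (hcodim : ∀ q : HeightOnePrime B, ∃ s, φ s ∉ q.1.asIdeal ∧ ∀ m : N, t • m = 0 → s • m = 0)
    {x : A} (hx : x ∈ charIdeal A N) : φ x ∈ charIdeal B N₁ := by
  by_cases htors : Module.IsTorsion A N
  swap
  · obtain ⟨-, h⟩ | ⟨h, -⟩ := hA.isCharIdeal_charIdeal (M := N)
    · rw [h, Ideal.mem_bot] at hx
      rw [hx, map_zero]
      exact zero_mem _
    · exact absurd h htors
  have hmem : ∀ a, a ∈ Ideal.span {t} ↔ φ a = 0 := fun a => by rw [← hker, RingHom.mem_ker]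
  have hφt : φ t = 0 := (hmem t).mp (Ideal.mem_span_singleton_self t)
  -- This rests on `hgen` rather than `hcodim`, which is vacuous when `B` has no primes of height
  -- one, as for a field.
  have htors' : Module.IsTorsion B N₁ := by
    obtain ⟨s, hs, hsN⟩ := hgen
    obtain ⟨a, ha, haN⟩ := exists_notMem_span_smul_eq_zero htors
      (hker ▸ RingHom.ker_isPrime φ) (fun h => hs ((hmem s).mp h)) hsN
    intro m
    obtain ⟨m, rfl⟩ := hν m
    refine ⟨⟨φ a, mem_nonZeroDivisors_of_ne_zero fun h => ha ((hmem a).mpr h)⟩, ?_⟩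
    change φ a • ν m = 0
    rw [← LinearMap.map_smulₛₗ, haN, map_zero]
  obtain ⟨J, hJ, hJloc⟩ := (hA.isCharIdeal_charIdeal (M := N)).exists_eq_divisorialHull hA htors
  obtain ⟨J', hJ', hJloc'⟩ :=
    (hB.isCharIdeal_charIdeal (M := N₁)).exists_eq_divisorialHull hB htors'
  rw [hJ', divisorialHull, Ideal.mem_iInf]
  intro q
  have := hB.isDVR q
  obtain ⟨n, D, g, hg⟩ := exists_isPresentationAt_comap hφ hker q.1.asIdeal (hcodim q)
  obtain ⟨g', hg'⟩ := hg.exists_descend hφ hφt ν hν hνker q.1.asIdeal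
  have hdet' := hg'.det_ne_zero q.1.asIdeal.primeCompl_le_nonZeroDivisors htors'
  have hmapdet : (D.map φ).det = φ D.det := by rw [RingHom.map_det]; rfl
  have hdet : D.det ≠ 0 := by
    rintro h
    rw [hmapdet, h, map_zero] at hdet'
    exact hdet' rfl
  -- A presentation at `φ⁻¹ q` remains one at every smaller prime, so a single determinant serves
  -- all of them.
  have hloc : ∀ p : HeightOnePrime A, p.1.asIdeal ≤ q.1.asIdeal.comap φ →
      ∃ s ∉ p.1.asIdeal, ∃ y, s * x = D.det * y := by
    intro p hp
    have hgp : IsPresentationAt p.1.asIdeal.primeCompl D g := hg.mono fun s hs h => hs (hp h)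
    rw [hJ, divisorialHull, Ideal.mem_iInf] at hx
    have := hx p
    rwa [Ideal.mem_comap, hJloc p n D g hgp hdet,
      Localization.AtPrime.algebraMap_mem_span_iff] at this
  obtain ⟨s, hs, y, hy⟩ := hA.exists_notMem_mul_eq_mul (q.1.asIdeal.comap φ) hdet hloc
  rw [Ideal.mem_comap, hJloc' q n _ g' hg' hdet', Localization.AtPrime.algebraMap_mem_span_iff]
  exact ⟨φ s, hs, φ y, by rw [hmapdet, ← map_mul, hy, map_mul]⟩

section Descent

variable {A : Type u} {B : Type v} [CommRing A] [CommRing B] [IsDomain A]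
  [IsDomain B] [IsNoetherianRing A] [IsNoetherianRing B] {φ : A →+* B}
  {N : Type w} [AddCommGroup N] [Module A N] [Module.Finite A N]

/-- Pseudo-nullity is used twice: being finitely generated and torsion kills the `t`-torsion
generically, and the height bound kills it in codimension one. -/
theorem map_charIdeal_mem_charIdealQuotient (hA : IsKrullDomain A)
    (hB : IsKrullDomain B) (hφ : Function.Surjective φ) {t : A}
    (hker : RingHom.ker φ = Ideal.span {t}) (hN : IsPseudoNullTorsion φ hφ N)
    {x : A} (hx : x ∈ charIdeal A N) : φ x ∈ charIdealQuotient φ hφ N := by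
  let := quotientDescent φ hφ N
  let := torsionDescent φ hφ N
  let ν : N →ₛₗ[φ] N ⧸ RingHom.ker φ • (⊤ : Submodule A N) :=
    { toFun := fun m => Submodule.Quotient.mk m
      map_add' := fun _ _ => rfl
      map_smul' := fun r m => (quotientDescent_smul φ hφ N r (Submodule.Quotient.mk m)).symm }
  have hν : Function.Surjective ν := Submodule.Quotient.mk_surjective _
  have : RingHomSurjective φ := ⟨hφ⟩
  have : Module.Finite B (N ⧸ RingHom.ker φ • (⊤ : Submodule A N)) :=
    Module.Finite.of_surjective ν hν
  have hN' : IsPseudoNull B (Submodule.torsionBySet A N (RingHom.ker φ)) := hN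
  have hmem : ∀ m : N, t • m = 0 → m ∈ Submodule.torsionBySet A N (RingHom.ker φ) := by
    intro m hm
    rw [Submodule.mem_torsionBySet_iff]
    rintro ⟨a, ha⟩
    rw [SetLike.mem_coe, hker, Ideal.mem_span_singleton'] at ha
    obtain ⟨c, rfl⟩ := ha
    rw [mul_smul, hm, smul_zero]
  have hkill : ∀ s, (∀ m : Submodule.torsionBySet A N (RingHom.ker φ), φ s • m = 0) →
      ∀ m : N, t • m = 0 → s • m = 0 := by
    intro s hs m hm
    have := hs ⟨m, hmem m hm⟩
    rw [torsionDescent_smul φ hφ N] at this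
    exact congrArg Subtype.val this
  refine map_charIdeal_mem hA hB hφ hker ν hν (fun m hm => ?_) ?_ (fun q => ?_) hx
  · have h1 : m ∈ RingHom.ker φ • (⊤ : Submodule A N) :=
      (Submodule.Quotient.mk_eq_zero _).mp hm
    rw [hker, Submodule.ideal_span_singleton_smul] at h1
    obtain ⟨m', -, hm'⟩ := h1
    exact ⟨m', hm'.symm⟩
  · have := hN'.1
    obtain ⟨b, hb, hbN⟩ := hN'.2.1.exists_ne_zero_smul_eq_zero
    obtain ⟨s, rfl⟩ := hφ b
    exact ⟨s, hb, hkill s hbN⟩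
  · obtain ⟨b, hb, hbN⟩ := hN'.exists_notMem_smul_eq_zero q
    obtain ⟨s, rfl⟩ := hφ b
    exact ⟨s, hb, hkill s hbN⟩

end Descent

/-! ### Inverse limits and the main theorem -/

section InverseLimit

/-- A compatible family defined from some level on extends to all levels. -/
theorem exists_extend_compatible {X : ℕ → Type u} (f : ∀ d, X (d + 1) → X d) (d₀ : ℕ)
    (x : ∀ d, d₀ ≤ d → X d) (hx : ∀ d (h : d₀ ≤ d), f d (x (d + 1) (h.trans d.le_succ)) = x d h) :
    ∃ y : ∀ d, X d, (∀ d, f d (y (d + 1)) = y d) ∧ ∀ d h, y d = x d h := by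
  induction d₀ with
  | zero => exact ⟨fun d => x d d.zero_le, fun d => hx d d.zero_le, fun _ _ => rfl⟩
  -- Applying the transition map to the family supplies the missing level `d₀`; compatibility leaves
  -- the higher levels unchanged.
  | succ d₀ ih =>
    obtain ⟨y, hy, hyx⟩ := ih (fun d h => f d (x (d + 1) (Nat.succ_le_succ h)))
      (fun d h => congrArg (f d) (hx (d + 1) (Nat.succ_le_succ h)))
    exact ⟨y, hy, fun d h => (hyx d (Nat.le_of_succ_le h)).trans (hx d h)⟩

/-- An inverse limit may be computed from the levels `d ≥ d₀`. -/
theorem IsInverseLimit.tail {X : ℕ → Type u} {f : ∀ d, X (d + 1) → X d} {L : Type v}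
    {p : ∀ d, L → X d} (h : IsInverseLimit f p) (d₀ : ℕ) :
    IsInverseLimit (X := fun k => X (d₀ + k)) (fun k => f (d₀ + k)) fun k => p (d₀ + k) := by
  refine ⟨fun k => h.1 (d₀ + k), fun x hx => ?_⟩
  have hz : ∀ d, d₀ ≤ d → ∃ z : X d, ∀ k (e : d₀ + k = d), e ▸ x k = z := by
    intro d hd
    obtain ⟨k, rfl⟩ := Nat.exists_eq_add_of_le hd
    refine ⟨x k, fun k' e => ?_⟩
    obtain rfl : k' = k := Nat.add_left_cancel e
    rfl
  choose z hz using hz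
  have hzx : ∀ k hk, z (d₀ + k) hk = x k := fun k hk => (hz _ hk k rfl).symm
  obtain ⟨y, hy, hyz⟩ := exists_extend_compatible f d₀ z (by
    intro d hd
    obtain ⟨k, rfl⟩ := Nat.exists_eq_add_of_le hd
    rw [hzx k, ← hx k]
    exact congrArg _ (hzx (k + 1) _))
  obtain ⟨l, hl, hluniq⟩ := h.2 y hy
  refine ⟨l, fun k => ?_, fun l' hl' => hluniq l' ?_⟩
  · exact (hl _).trans ((hyz _ (Nat.le_add_right _ _)).trans (hzx k _))
  · have hge : ∀ k, p (d₀ + k) l' = y (d₀ + k) := fun k =>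
      (hl' k).trans ((hzx k _).symm.trans (hyz _ (Nat.le_add_right _ _)).symm)
    -- Below `d₀` the components are forced by descending along the transition maps.
    have hdown : ∀ k d, d + k = d₀ → p d l' = y d := by
      intro k
      induction k with
      | zero => rintro d rfl; exact hge 0
      | succ k ih =>
        intro d hd
        rw [← h.1 d l', ← hy d, ih (d + 1) (by omega)]
    intro d
    rcases le_total d₀ d with hd | hd
    · obtain ⟨k, rfl⟩ := Nat.exists_eq_add_of_le hd
      exact hge k
    · exact hdown (d₀ - d) d (by omega)

end InverseLimit

/-- Indices are shifted by one: `t d` lives in level `d + 1`, so conditions at levels above `d₀` are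
stated for `d ≥ d₀`. -/
theorem theorem2p10 {Λ : ℕ → Type u} [∀ d, CommRing (Λ d)] [∀ d, IsDomain (Λ d)]
    [∀ d, IsNoetherianRing (Λ d)] (hKrull : ∀ d, IsKrullDomain (Λ d))
    (φ : ∀ d, Λ (d + 1) →+* Λ d) (hφ : ∀ d, Function.Surjective (φ d))
    (t : ∀ d, Λ (d + 1)) (hker : ∀ d, RingHom.ker (φ d) = Ideal.span {t d})
    (hprime : ∀ d, (Ideal.span {t d}).IsPrime) (hheight : ∀ d, (Ideal.span {t d}).height = 1)
    (hcomplete : ∀ d, IsAdicComplete (Ideal.span {t d}) (Λ (d + 1)))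
    {Λlim : Type*} [CommRing Λlim] (π : ∀ d, Λlim →+* Λ d)
    (hΛlim : IsInverseLimit (fun d => φ d) (fun d => π d))
    {M : ℕ → Type v} [∀ d, AddCommGroup (M d)] [∀ d, Module (Λ d) (M d)]
    [∀ d, Module.Finite (Λ d) (M d)] (ψ : ∀ d, M (d + 1) →ₛₗ[φ d] M d)
    {Mlim : Type*} [AddCommGroup Mlim] [Module Λlim Mlim] [Module.Finite Λlim Mlim]
    (ρ : ∀ d, Mlim →ₛₗ[π d] M d) (hMlim : IsInverseLimit (fun d => ψ d) (fun d => ρ d))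
    (d₀ : ℕ)
    (h₁ : ∀ d ≥ d₀, IsPseudoNullTorsion (φ d) (hφ d) (M (d + 1)))
    (h₂ : ∀ d ≥ d₀, charIdealQuotient (φ d) (hφ d) (M (d + 1)) ≤ charIdeal (Λ d) (M d)) :
    -- the characteristic ideals form an inverse system under the transition maps of the rings
    ∃ hφCh : ∀ d ≥ d₀, Set.MapsTo (φ d)
        (charIdeal (Λ (d + 1)) (M (d + 1))) (charIdeal (Λ d) (M d)),
    -- their preimages in the limit ring form an inverse system under inclusion
    ∃ hincl : ∀ d ≥ d₀, charPreimage π M (d + 1) ≤ charPreimage π M d,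
    -- the pro-characteristic ideal is the inverse limit of the preimages
    IsInverseLimit
        (X := fun k => charPreimage π M (d₀ + k)) (L := proCharIdeal π M d₀)
        (fun k => Submodule.inclusion (hincl (d₀ + k) (Nat.le_add_right d₀ k)))
        (fun k => Submodule.inclusion (proCharIdeal_le π M d₀ k)) ∧
    -- it is also the inverse limit of the characteristic ideals themselves
    IsInverseLimit
        (X := fun k => charIdeal (Λ (d₀ + k)) (M (d₀ + k))) (L := proCharIdeal π M d₀)
        (fun k => (hφCh (d₀ + k) (Nat.le_add_right d₀ k)).restrict)
        (fun k x => ⟨π (d₀ + k) x, proCharIdeal_le π M d₀ k x.2⟩) ∧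
    -- it does not depend on the level at which the system is started
    ∀ d₁ ≥ d₀, proCharIdeal π M d₁ = proCharIdeal π M d₀ := by
  have hφCh : ∀ d ≥ d₀, Set.MapsTo (φ d)
      (charIdeal (Λ (d + 1)) (M (d + 1))) (charIdeal (Λ d) (M d)) := fun d hd x hx =>
    h₂ d hd (map_charIdeal_mem_charIdealQuotient (hKrull (d + 1)) (hKrull d) (hφ d) (hker d)
      (h₁ d hd) hx)
  have hπ : ∀ d x, φ d (π (d + 1) x) = π d x := hΛlim.1
  have hincl : ∀ d ≥ d₀, charPreimage π M (d + 1) ≤ charPreimage π M d := by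
    intro d hd x hx
    have := hφCh d hd (Ideal.mem_comap.mp hx)
    rwa [hπ] at this
  have hanti : ∀ d ≥ d₀, ∀ k, charPreimage π M (d + k) ≤ charPreimage π M d := by
    intro d hd k
    induction k with
    | zero => exact le_rfl
    | succ k ih => exact (hincl (d + k) (hd.trans (Nat.le_add_right d k))).trans ih
  refine ⟨hφCh, hincl, ⟨fun _ _ => rfl, fun x hx => ?_⟩, ⟨fun k l => Subtype.ext (hπ _ _),
    fun x hx => ?_⟩, fun d₁ hd₁ => ?_⟩
  · have hval : ∀ k, (x k : Λlim) = x 0 := by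
      intro k
      induction k with
      | zero => rfl
      | succ k ih => exact (congrArg Subtype.val (hx k)).trans ih
    have hmem : (x 0 : Λlim) ∈ proCharIdeal π M d₀ :=
      (Submodule.mem_iInf _).mpr fun k => hval k ▸ (x k).2
    exact ⟨⟨x 0, hmem⟩, fun k => Subtype.ext (hval k).symm,
      fun l hl => Subtype.ext (show (l : Λlim) = x 0 from congrArg Subtype.val (hl 0))⟩
  -- The family starts only at `d₀`, so the limit ring is taken over that tail; the resulting `l`
  -- lies in all preimages.
  · obtain ⟨l, hl, hluniq⟩ := (hΛlim.tail d₀).2 (fun k => (x k : Λ (d₀ + k)))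
      fun k => congrArg Subtype.val (hx k)
    have hmem : l ∈ proCharIdeal π M d₀ := (Submodule.mem_iInf _).mpr fun k => by
      have hlk : π (d₀ + k) l = x k := hl k
      rw [charPreimage, Ideal.mem_comap, hlk]
      exact (x k).2
    exact ⟨⟨l, hmem⟩, fun k => Subtype.ext (hl k),
      fun l' hl' => Subtype.ext (hluniq l' fun k => congrArg Subtype.val (hl' k))⟩
  · obtain ⟨j, rfl⟩ := Nat.exists_eq_add_of_le hd₁
    refine le_antisymm (le_iInf fun k => ?_) (le_iInf fun k => ?_)
    · refine (proCharIdeal_le π M (d₀ + j) k).trans ?_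
      rw [add_right_comm]
      exact hanti (d₀ + k) (Nat.le_add_right d₀ k) j
    · rw [add_assoc]
      exact proCharIdeal_le π M d₀ (j + k)
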